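/- Let $X$ be a real vector space with a metric $d$ such that vector addition and scalar multiplication are continuous for the topology of $d$ (a metric vector space). Let $C$ be a nonempty closed convex subset of $X$, and let $f\colon C \to C$ be a mapping, not assumed continuous, that satisfies the following conditions: (a) $f\colon C \to C$ is onto; (b$_2$) for every finite subset $\{x_1, \dots, x_n\} \subseteq C$ and all positive numbers $\alpha_1, \dots, \alpha_n$ with $\sum_{i=1}^n \alpha_i = 1$, the convex combination $u = \sum_{i=1}^n \alpha_i x_i$ satisfies $$\max\{d(f(x_j), u) - d(f(x_j), x_j) : j = 1, \dots, n\} \ge 0;$$ (c$_2$) there is a point $x^* \in C$ such that the set $$\{y \in C : d(f(x^*), x^*) \le d(f(x^*), y)\}$$ is compact. Then $f$ has a fixed point, that is, there is $x \in C$ with $f(x) = x$. -/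

import Mathlib

/-!
For `x ∈ C` let `G x` be the set of `y ∈ C` with `d (f x, x) ≤ d (f x, y)`. These sets are closed, and
the hypothesis on convex combinations says exactly that the convex hull of any finite set of points
is covered by the sets `G x` of those points. By the Knaster–Kuratowski–Mazurkiewicz lemma
(`exists_forall_eq_zero_of_kkm`), used on the simplex of weights, any finitely many sets `G x` meet;
as one of them is compact, there is a point `y` in all of them. By surjectivity `y = f x` for some
`x`, and `y ∈ G x` then reads `d (f x, x) ≤ d (f x, f x) = 0`.

The Knaster–Kuratowski–Mazurkiewicz lemma is deduced from a form of Brouwer's theorem for closed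
covers of the simplex (`exists_mem_of_closed_cover`). This follows by compactness from a labelling
lemma on finer and finer grids. Instead of a triangulation with Sperner's lemma, the argument uses
the lemma of Scarf on finite sets ordered in several ways (`exists_isDominant_image_eq_univ`), whose
proof is the same parity count: the simplices are the dominant sets for the coordinate orders, and
`IsDominant.card_completions` says that an interior facet belongs to exactly two of them.
-/

/-! ### Scarf's lemma -/

/-- A finite set `σ` is *dominant* for the family of rankings `r i` when no element strictly beats,
in every ranking at once, the lowest element of `σ`. -/
def IsDominant {I V α : Type*} [LE α] (r : I → V → α) (σ : Finset V) : Prop :=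
  ∀ y, ∃ i, ∀ x ∈ σ, r i y ≤ r i x

lemma IsDominant.mono {I V α : Type*} [LE α] {r : I → V → α} {σ τ : Finset V}
    (h : IsDominant r σ) (hτ : τ ⊆ σ) : IsDominant r τ := fun y =>
  (h y).imp fun _ hi x hx => hi x (hτ hx)

/-- A map whose image has one element less than its domain identifies exactly one pair. -/
lemma Finset.exists_unique_collision {A B : Type*} [DecidableEq A] [DecidableEq B]
    {s : Finset A} {f : A → B} (h : (s.image f).card + 1 = s.card) :
    ∃ a ∈ s, ∃ b ∈ s, a ≠ b ∧ f a = f b ∧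
      ∀ i ∈ s, ∀ j ∈ s, i ≠ j → f i = f j → (i = a ∧ j = b) ∨ (i = b ∧ j = a) := by
  have hlt : (s.image f).card < s.card := by omega
  obtain ⟨a, ha, b, hb, hab, hf⟩ := Finset.exists_ne_map_eq_of_card_lt_of_maps_to hlt
    (fun x hx => Finset.mem_image_of_mem f hx)
  have himg : (s.erase a).image f = s.image f := by
    ext y
    simp only [Finset.mem_image, Finset.mem_erase]
    constructor
    · rintro ⟨x, ⟨_, hx⟩, rfl⟩; exact ⟨x, hx, rfl⟩
    · rintro ⟨x, hx, rfl⟩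
      by_cases hxa : x = a
      · exact ⟨b, ⟨hab.symm, hb⟩, by rw [hxa, hf]⟩
      · exact ⟨x, ⟨hxa, hx⟩, rfl⟩
  have hinj : Set.InjOn f (s.erase a) := by
    rw [← Finset.card_image_iff, himg, Finset.card_erase_of_mem ha]; omega
  refine ⟨a, ha, b, hb, hab, hf, fun i hi j hj hij hfij => ?_⟩
  by_cases hia : i = a
  · refine Or.inl ⟨hia, hinj (by simp [hj, ← hia, hij.symm]) (by simp [hb, hab.symm]) ?_⟩
    rw [← hfij, hia, hf]
  · by_cases hja : j = a
    · refine Or.inr ⟨hinj (by simp [hi, hia]) (by simp [hb, hab.symm]) ?_, hja⟩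
      rw [hfij, hja, hf]
    · exact absurd (hinj (by simp [hi, hia]) (by simp [hj, hja]) hfij) hij

section Pivot

variable {I V α : Type*} [DecidableEq V] [LinearOrder α] {r : I → V → α}

/-- If `μ i` is the lowest element of the dominant set `τ` in the ranking `i`, and `a ≠ b` are the
only two rankings sharing their lowest element, then the elements completing `τ` to a dominant set
are, for `k = a` and for `k = b`, the `k`-highest among those that beat `μ i` for all `i ≠ k`. -/
lemma IsDominant.insert_iff (hr : ∀ i, Function.Injective (r i)) {τ : Finset V}
    (hτ : IsDominant r τ) {μ : I → V} (hμ : ∀ i, μ i ∈ τ) (hmin : ∀ i, ∀ x ∈ τ, r i (μ i) ≤ r i x)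
    {a b : I} (hab : a ≠ b) (hμab : μ a = μ b)
    (huniq : ∀ i j, i ≠ j → μ i = μ j → (i = a ∧ j = b) ∨ (i = b ∧ j = a)) (y : V) :
    (y ∉ τ ∧ IsDominant r (insert y τ)) ↔ ∃ k, (k = a ∨ k = b) ∧ (∀ i ≠ k, r i (μ i) < r i y) ∧
      ∀ z, (∀ i ≠ k, r i (μ i) < r i z) → r k z ≤ r k y := by
  constructor
  · rintro ⟨hy, hd⟩
    have hmem : ∀ i, ∃ j, μ j = μ i ∧ r j (μ j) < r j y := by
      intro i
      obtain ⟨j, hj⟩ := hd (μ i)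
      have h1 : μ j = μ i := hr j (le_antisymm (hmin j _ (hμ i))
        (hj _ (Finset.mem_insert_of_mem (hμ j))))
      refine ⟨j, h1, lt_of_le_of_ne (h1 ▸ hj y (Finset.mem_insert_self _ _)) fun h => hy ?_⟩
      rw [← hr j h]; exact hμ j
    obtain ⟨k, hk⟩ := hd y
    have hk' : ¬ r k (μ k) < r k y := not_lt.2 (hk _ (Finset.mem_insert_of_mem (hμ k)))
    have hkab : k = a ∨ k = b := by
      obtain ⟨j, hj, hlt⟩ := hmem k
      have hjk : j ≠ k := by rintro rfl; exact hk' hlt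
      rcases huniq j k hjk hj with h | h
      · exact Or.inr h.2
      · exact Or.inl h.2
    have hM : ∀ i ≠ k, r i (μ i) < r i y := by
      intro i hi
      obtain ⟨j, hj, hlt⟩ := hmem i
      by_cases hji : j = i
      · rwa [hji] at hlt
      · -- the only alternative is `j = k`, excluded by the choice of `k`
        have hjk : j = k := by
          rcases huniq j i hji hj with ⟨h1, h2⟩ | ⟨h1, h2⟩ <;> rcases hkab with h | h <;> grind
        rw [hjk] at hlt; exact absurd hlt hk'
    refine ⟨k, hkab, hM, fun z hz => ?_⟩
    obtain ⟨i, hi⟩ := hd z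
    by_cases hik : i = k
    · rw [← hik]; exact hi y (Finset.mem_insert_self _ _)
    · exact absurd (hz i hik) (not_lt.2 (hi _ (Finset.mem_insert_of_mem (hμ i))))
  · rintro ⟨k, hk, hM, hmax⟩
    constructor
    · intro hy
      obtain ⟨i, hi⟩ := hτ y
      have h1 : y = μ i := hr i (le_antisymm (hi _ (hμ i)) (hmin i y hy))
      have h2 : ∃ j ≠ k, y = μ j := by
        by_cases hik : i = k
        · rcases hk with rfl | rfl
          · exact ⟨b, hab.symm, by rw [h1, hik, hμab]⟩
          · exact ⟨a, hab, by rw [h1, hik, hμab]⟩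
        · exact ⟨i, hik, h1⟩
      obtain ⟨j, hjk, hj⟩ := h2
      have := hM j hjk
      rw [← hj] at this
      exact lt_irrefl _ this
    · intro z
      by_cases hz : ∀ i ≠ k, r i (μ i) < r i z
      · refine ⟨k, fun x hx => ?_⟩
        rcases Finset.mem_insert.1 hx with rfl | hx
        · exact hmax z hz
        · obtain ⟨i, hi⟩ := hτ z
          by_cases hik : i = k
          · rw [← hik]; exact hi x hx
          · exact absurd (hz i hik) (not_lt.2 (hi _ (hμ i)))
      · push Not at hz
        obtain ⟨i, hik, hi⟩ := hz
        refine ⟨i, fun x hx => ?_⟩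
        rcases Finset.mem_insert.1 hx with rfl | hx
        · exact hi.trans (hM i hik).le
        · exact hi.trans (hmin i x hx)

variable [Fintype I] [DecidableEq I] [Fintype V]

open Classical in
/-- The pivoting step: away from the boundary facets, a dominant set with one element missing can be
completed in exactly two ways. -/
lemma IsDominant.card_completions (hr : ∀ i, Function.Injective (r i)) {e : I → V}
    (he : ∀ i v, v ≠ e i → r i (e i) < r i v)
    (he' : ∀ i j v, j ≠ i → v ∉ Set.range e → r i v < r i (e j)) {τ : Finset V}
    (hτ : IsDominant r τ) (hcard : τ.card + 1 = Fintype.card I) {t : V} (ht : t ∈ τ)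
    (hte : t ∉ Set.range e) :
    (Finset.univ.filter fun y => y ∉ τ ∧ IsDominant r (insert y τ)).card = 2 := by
  have h0 : ∀ i, ∃ m ∈ τ, ∀ x ∈ τ, r i m ≤ r i x := fun i =>
    Finset.exists_min_image τ (r i) ⟨t, ht⟩
  choose μ hμ hmin using h0
  have himg : Finset.univ.image μ = τ := by
    ext x
    simp only [Finset.mem_image, Finset.mem_univ, true_and]
    constructor
    · rintro ⟨i, rfl⟩; exact hμ i
    · intro hx
      obtain ⟨i, hi⟩ := hτ x
      exact ⟨i, hr i (le_antisymm (hmin i x hx) (hi _ (hμ i)))⟩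
  obtain ⟨a, -, b, -, hab, hμab, huniq⟩ := Finset.exists_unique_collision
    (s := Finset.univ) (f := μ) (by rw [himg, hcard, Finset.card_univ])
  simp only [Finset.mem_univ, true_implies] at huniq
  -- a minimum in ranking `i` is `e i` or not of the form `e j`, since `t` is below all other `e j`
  have hμe : ∀ i j, μ i = e j → i = j := by
    intro i j h
    by_contra hij
    have := hmin i t ht
    rw [h] at this
    exact absurd (he' i j t (Ne.symm hij) hte) (not_lt.2 this)
  have hbelow : ∀ k, ∀ i ≠ k, r i (μ i) < r i (e k) := by
    intro k i hik
    by_cases h : μ i ∈ Set.range e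
    · obtain ⟨j, hj⟩ := h
      have hij := hμe i j hj.symm
      rw [← hj, ← hij]
      apply he
      intro hek
      -- `t` lies strictly between `e i` and `e k` in the ranking `i`
      have h1 := he' i k t (Ne.symm hik) hte
      rw [hek] at h1
      have h2 := he i t (fun h => hte ⟨i, h.symm⟩)
      exact lt_asymm h1 h2
    · exact he' i k _ (Ne.symm hik) h
  have hmax : ∀ k, ∃ y, (∀ i ≠ k, r i (μ i) < r i y) ∧
      ∀ z, (∀ i ≠ k, r i (μ i) < r i z) → r k z ≤ r k y := by
    intro k
    obtain ⟨y, hy, hym⟩ := Finset.exists_max_image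
      (Finset.univ.filter fun y => ∀ i ≠ k, r i (μ i) < r i y) (r k)
      ⟨e k, by simpa using hbelow k⟩
    simp only [Finset.mem_filter, Finset.mem_univ, true_and] at hy hym
    exact ⟨y, hy, hym⟩
  obtain ⟨p, hp, hpm⟩ := hmax a
  obtain ⟨q, hq, hqm⟩ := hmax b
  rw [Finset.card_eq_two]
  refine ⟨p, q, ?_, ?_⟩
  · rintro rfl
    obtain ⟨i, hi⟩ := hτ p
    have hi' := hi _ (hμ i)
    by_cases hia : i = a
    · exact absurd (hq i (hia ▸ hab)) (not_lt.2 hi')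
    · exact absurd (hp i hia) (not_lt.2 hi')
  · ext y
    simp only [Finset.mem_filter, Finset.mem_univ, true_and, Finset.mem_insert,
      Finset.mem_singleton]
    rw [hτ.insert_iff hr hμ hmin hab hμab huniq]
    constructor
    · rintro ⟨k, rfl | rfl, hk, hkm⟩
      · exact Or.inl (hr k (le_antisymm (hpm y hk) (hkm p hp)))
      · exact Or.inr (hr k (le_antisymm (hqm y hk) (hkm q hq)))
    · rintro (rfl | rfl)
      · exact ⟨a, Or.inl rfl, hp, hpm⟩
      · exact ⟨b, Or.inr rfl, hq, hqm⟩

open Classical in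
/-- A boundary facet, the set of all `e i` with `i ≠ i₀`, has exactly one completion, namely the
`i₀`-highest remaining element. -/
lemma card_completions_facet (hr : ∀ i, Function.Injective (r i)) {e : I → V}
    (he : ∀ i v, v ≠ e i → r i (e i) < r i v)
    (he' : ∀ i j v, j ≠ i → v ∉ Set.range e → r i v < r i (e j)) {i₀ : I} {t : V}
    (hte : t ∉ Set.range e) :
    (Finset.univ.filter fun y => y ∉ (Finset.univ.erase i₀).image e ∧
      IsDominant r (insert y ((Finset.univ.erase i₀).image e))).card = 1 := by
  set τ := (Finset.univ.erase i₀).image e with hτ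
  have hmem : ∀ v, v ∈ τ ↔ ∃ i ≠ i₀, e i = v := by
    intro v; simp [hτ]
  have htτ : t ∉ τ := by
    rw [hmem]; rintro ⟨i, -, h⟩; exact hte ⟨i, h⟩
  obtain ⟨p, hp, hpm⟩ := Finset.exists_max_image
    (Finset.univ.filter fun y => y ∉ τ) (r i₀) ⟨t, by simpa using htτ⟩
  simp only [Finset.mem_filter, Finset.mem_univ, true_and] at hp hpm
  rw [Finset.card_eq_one]
  refine ⟨p, ?_⟩
  ext y
  simp only [Finset.mem_filter, Finset.mem_univ, true_and, Finset.mem_singleton]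
  constructor
  · rintro ⟨hy, hd⟩
    refine hr i₀ (le_antisymm (hpm y hy) ?_)
    obtain ⟨i, hi⟩ := hd p
    by_cases hi0 : i = i₀
    · rw [← hi0]; exact hi y (Finset.mem_insert_self _ _)
    · have hei : e i ∈ τ := (hmem _).2 ⟨i, hi0, rfl⟩
      refine absurd (he i p ?_) (not_lt.2 (hi _ (Finset.mem_insert_of_mem hei)))
      rintro rfl; exact hp hei
  · rintro rfl
    refine ⟨hp, fun z => ?_⟩
    have hlow : ∀ i x, r i (e i) ≤ r i x := by
      intro i x
      by_cases h : x = e i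
      · rw [h]
      · exact (he i x h).le
    by_cases hz : z ∈ τ
    · obtain ⟨i, -, rfl⟩ := (hmem z).1 hz
      exact ⟨i, fun x _ => hlow i x⟩
    · refine ⟨i₀, fun x hx => ?_⟩
      rcases Finset.mem_insert.1 hx with rfl | hx
      · exact hpm z hz
      · obtain ⟨j, hj, rfl⟩ := (hmem x).1 hx
        by_cases hze : z ∈ Set.range e
        · obtain ⟨l, rfl⟩ := hze
          have : l = i₀ := by
            by_contra h
            exact hz ((hmem _).2 ⟨l, h, rfl⟩)
          rw [this]; exact hlow _ _
        · exact (he' i₀ j z hj hze).le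

open Classical in
/-- **Scarf's lemma.** The set of elements is augmented by one slack element `e i` for each ranking
`i`, lowest in the ranking `i` and above all ordinary elements in the others. Then for every
labelling `c` with `c (e i) = i` some dominant set carries every label. -/
lemma exists_isDominant_image_eq_univ (hr : ∀ i, Function.Injective (r i)) {e : I → V}
    (he : ∀ i v, v ≠ e i → r i (e i) < r i v)
    (he' : ∀ i j v, j ≠ i → v ∉ Set.range e → r i v < r i (e j)) {t : V}
    (hte : t ∉ Set.range e) {c : V → I} (hc : ∀ i, c (e i) = i) [Nonempty I] :
    ∃ σ : Finset V, IsDominant r σ ∧ σ.image c = Finset.univ := by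
  by_contra! hcon
  obtain ⟨i₀⟩ := ‹Nonempty I›
  -- pairs of a set with all labels but `i₀` and an element completing it to a dominant set
  let P : Finset (Finset V × V) := Finset.univ.filter fun p =>
    (p.1.card + 1 = Fintype.card I ∧ p.1.image c = Finset.univ.erase i₀) ∧
      (p.2 ∉ p.1 ∧ IsDominant r (insert p.2 p.1))
  have hcardI : (Finset.univ.erase i₀).card + 1 = Fintype.card I := by
    rw [Finset.card_erase_add_one (Finset.mem_univ _), Finset.card_univ]
  have hmemP : ∀ τ y, (τ, y) ∈ P ↔ (τ.card + 1 = Fintype.card I ∧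
      τ.image c = Finset.univ.erase i₀) ∧ (y ∉ τ ∧ IsDominant r (insert y τ)) := by
    intro τ y; simp [P]
  -- each dominant set arises from no such pair or from exactly two
  have heven : Even P.card := by
    rw [Finset.card_eq_sum_card_fiberwise (f := fun p => insert p.2 p.1) (t := Finset.univ)
      (fun _ _ => Finset.mem_coe.2 (Finset.mem_univ _))]
    refine Finset.even_sum _ fun σ _ => ?_
    rcases Finset.eq_empty_or_nonempty (P.filter fun p => insert p.2 p.1 = σ) with h | h
    · rw [h]; simp
    obtain ⟨⟨τ, y⟩, hp⟩ := h
    obtain ⟨hP, rfl⟩ := Finset.mem_filter.1 hp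
    obtain ⟨⟨hcard, himg⟩, hy, hd⟩ := (hmemP τ y).1 hP
    have hcy : c y ≠ i₀ := by
      intro h
      apply hcon _ hd
      rw [Finset.image_insert, himg, h, Finset.insert_erase (Finset.mem_univ _)]
    have himg' : (insert y τ).image c = Finset.univ.erase i₀ := by
      rw [Finset.image_insert, himg, Finset.insert_eq_of_mem (by simp [hcy])]
    obtain ⟨a, ha, b, hb, hab, hcab, huniq⟩ := Finset.exists_unique_collision
      (s := insert y τ) (f := c) (by rw [himg', hcardI, Finset.card_insert_of_notMem hy, hcard])
    have hera : ∀ a ∈ insert y τ, ∀ b ∈ insert y τ, a ≠ b → c a = c b →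
        ((insert y τ).erase a, a) ∈ P := by
      intro a ha b hb hab hcab
      rw [hmemP]
      refine ⟨⟨?_, ?_⟩, by simp, by rwa [Finset.insert_erase ha]⟩
      · rw [Finset.card_erase_add_one ha, Finset.card_insert_of_notMem hy, hcard]
      · rw [← himg']
        refine subset_antisymm (Finset.image_subset_image (Finset.erase_subset _ _)) ?_
        intro i hi
        obtain ⟨x, hx, rfl⟩ := Finset.mem_image.1 hi
        by_cases hxa : x = a
        · exact Finset.mem_image.2 ⟨b, Finset.mem_erase.2 ⟨hab.symm, hb⟩, by rw [hxa, hcab]⟩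
        · exact Finset.mem_image.2 ⟨x, Finset.mem_erase.2 ⟨hxa, hx⟩, rfl⟩
    have hpair : (P.filter fun p => insert p.2 p.1 = insert y τ) =
        {((insert y τ).erase a, a), ((insert y τ).erase b, b)} := by
      ext ⟨ρ, z⟩
      simp only [Finset.mem_filter, Finset.mem_insert (α := Finset V × V), Finset.mem_singleton,
        Prod.mk.injEq]
      constructor
      · rintro ⟨hρP, hins⟩
        obtain ⟨⟨hρc, hρi⟩, hz, -⟩ := (hmemP ρ z).1 hρP
        have hρ : ρ = (insert y τ).erase z := by rw [← hins, Finset.erase_insert hz]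
        have hinj : Set.InjOn c ρ := by
          rw [← Finset.card_image_iff, hρi]; omega
        by_cases hza : z = a
        · left; exact ⟨by rw [hρ, hza], hza⟩
        by_cases hzb : z = b
        · right; exact ⟨by rw [hρ, hzb], hzb⟩
        refine absurd (hinj ?_ ?_ hcab) hab
        · rw [hρ]; exact Finset.mem_coe.2 (Finset.mem_erase.2 ⟨Ne.symm hza, ha⟩)
        · rw [hρ]; exact Finset.mem_coe.2 (Finset.mem_erase.2 ⟨Ne.symm hzb, hb⟩)
      · rintro (⟨rfl, rfl⟩ | ⟨rfl, rfl⟩)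
        · exact ⟨hera _ ha _ hb hab hcab, Finset.insert_erase ha⟩
        · exact ⟨hera _ hb _ ha hab.symm hcab.symm, Finset.insert_erase hb⟩
    rw [hpair, Finset.card_pair (by simp [hab])]
    exact even_two
  -- only the facet of all `e i` with `i ≠ i₀` is completed an odd number of times
  have hodd : Odd P.card := by
    have hfib : ∀ τ : Finset V, (P.filter fun p => p.1 = τ).card =
        if τ.card + 1 = Fintype.card I ∧ τ.image c = Finset.univ.erase i₀ then
          (Finset.univ.filter fun y => y ∉ τ ∧ IsDominant r (insert y τ)).card else 0 := by
      intro τ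
      split_ifs with h
      · symm
        refine Finset.card_bij (fun y _ => (τ, y)) ?_ ?_ ?_
        · intro y hy
          exact Finset.mem_filter.2 ⟨(hmemP τ y).2 ⟨h, (Finset.mem_filter.1 hy).2⟩, rfl⟩
        · intro y _ z _ hyz; exact (Prod.mk.inj hyz).2
        · rintro ⟨ρ, y⟩ hy
          obtain ⟨h1, rfl⟩ := Finset.mem_filter.1 hy
          exact ⟨y, Finset.mem_filter.2 ⟨Finset.mem_univ _, ((hmemP _ y).1 h1).2⟩, rfl⟩
      · rw [Finset.card_eq_zero, Finset.filter_eq_empty_iff]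
        rintro ⟨ρ, y⟩ hy rfl
        exact h ((hmemP _ y).1 hy).1
    have heinj : Function.Injective e := fun i j h => by rw [← hc i, h, hc]
    set τ₀ := (Finset.univ.erase i₀).image e with hτ₀
    rw [Finset.card_eq_sum_card_fiberwise (f := fun p => p.1) (t := Finset.univ)
      (fun _ _ => Finset.mem_coe.2 (Finset.mem_univ _)),
      ← Finset.add_sum_erase _ _ (Finset.mem_univ τ₀)]
    refine Odd.add_even ?_ (Finset.even_sum _ fun τ hτ => ?_)
    · rw [hfib, if_pos, card_completions_facet hr he he' hte]
      · exact odd_one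
      · refine ⟨?_, ?_⟩
        · rw [hτ₀, Finset.card_image_of_injective _ heinj, hcardI]
        · rw [hτ₀, Finset.image_image]
          simp [Function.comp_def, hc]
    · rw [hfib]
      split_ifs with h
      swap
      · exact Even.zero
      by_cases hd : IsDominant r τ
      · by_cases hsub : ∃ v ∈ τ, v ∉ Set.range e
        · obtain ⟨v, hv, hve⟩ := hsub
          rw [hd.card_completions hr he he' h.1 hv hve]
          exact even_two
        · push Not at hsub
          refine absurd ?_ (Finset.ne_of_mem_erase hτ)
          ext v
          have h2 := h.2
          simp only [hτ₀, Finset.mem_image, Finset.mem_erase, Finset.mem_univ, and_true]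
          constructor
          · intro hv
            obtain ⟨i, rfl⟩ := hsub v hv
            have : c (e i) ∈ τ.image c := Finset.mem_image_of_mem c hv
            rw [h2, hc] at this
            exact ⟨i, Finset.ne_of_mem_erase this, rfl⟩
          · rintro ⟨i, hi, rfl⟩
            have : i ∈ τ.image c := by rw [h2]; simp [hi]
            obtain ⟨v, hv, hvi⟩ := Finset.mem_image.1 this
            obtain ⟨j, rfl⟩ := hsub v hv
            rw [hc] at hvi
            rwa [← hvi]
      · have : (Finset.univ.filter fun y => y ∉ τ ∧ IsDominant r (insert y τ)) = ∅ := by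
          rw [Finset.filter_eq_empty_iff]
          rintro y - ⟨-, hy⟩
          exact hd (hy.mono (Finset.subset_insert _ _))
        rw [this]; simp
  exact (Nat.not_even_iff_odd.2 hodd) heven

end Pivot

/-- Scarf's lemma without slack elements and for rankings with ties. -/
lemma exists_dominant_labels {I T : Type*} [Fintype I] [Fintype T] [Nonempty T] {N : ℕ}
    (r : I → T → ℕ) (hN : ∀ i t, r i t ≤ N) (c : T → I) :
    ∃ σ : Finset T, σ.Nonempty ∧ ∀ y, ∃ i, (∃ z ∈ σ, c z = i) ∧ ∀ x ∈ σ, r i y ≤ r i x := by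
  classical
  obtain ⟨t₀⟩ := ‹Nonempty T›
  have : Nonempty I := ⟨c t₀⟩
  let q : I → I ⊕ T → ℕ := fun i v => Sum.elim (fun j => if j = i then 0 else N + 2)
    (fun t => r i t + 1) v
  -- ties are broken by an arbitrary enumeration
  let R : I → I ⊕ T → ℕ ×ₗ Fin (Fintype.card (I ⊕ T)) := fun i v =>
    toLex (q i v, Fintype.equivFin (I ⊕ T) v)
  have hlt : ∀ i v w, q i v < q i w → R i v < R i w := fun i v w h =>
    Prod.Lex.toLex_lt_toLex.2 (Or.inl h)
  have hle : ∀ i v w, R i v ≤ R i w → q i v ≤ q i w := fun i v w h =>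
    not_lt.1 fun h' => absurd (hlt i w v h') (not_lt.2 h)
  obtain ⟨σ, hσ, himg⟩ := exists_isDominant_image_eq_univ (r := R) (e := Sum.inl)
    (t := Sum.inr t₀) (c := Sum.elim id c)
    (fun i v w h => (Fintype.equivFin (I ⊕ T)).injective (Prod.mk.inj (toLex.injective h)).2)
    (by
      rintro i (j | t) h
      · apply hlt
        have : j ≠ i := fun h' => h (by rw [h'])
        simp [q, this]
      · apply hlt; simp [q])
    (by
      rintro i j (k | t) hj h
      · simp at h
      · apply hlt
        have := hN i t
        simp only [q, Sum.elim_inl, Sum.elim_inr, if_neg hj]; omega)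
    (by simp) (by simp)
  have hlab : ∀ i, Sum.inl i ∉ σ → ∃ z, Sum.inr z ∈ σ ∧ c z = i := by
    intro i hi
    have : i ∈ σ.image (Sum.elim id c) := by rw [himg]; simp
    obtain ⟨(j | z), hv, hvi⟩ := Finset.mem_image.1 this
    · simp only [Sum.elim_inl, id] at hvi
      exact absurd (hvi ▸ hv) hi
    · exact ⟨z, hv, hvi⟩
  have key : ∀ y, ∃ i, (∃ z, Sum.inr z ∈ σ ∧ c z = i) ∧ ∀ x, Sum.inr x ∈ σ → r i y ≤ r i x := by
    intro y
    obtain ⟨i, hi⟩ := hσ (Sum.inr y)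
    refine ⟨i, hlab i fun h => ?_, fun x hx => ?_⟩
    · have := hle _ _ _ (hi _ h)
      simp [q] at this
    · have := hle _ _ _ (hi _ hx)
      simpa [q] using this
  refine ⟨Finset.univ.filter fun t => Sum.inr t ∈ σ, ?_, fun y => ?_⟩
  · obtain ⟨i, ⟨z, hz, -⟩, -⟩ := key t₀
    exact ⟨z, by simpa using hz⟩
  · simpa using key y

/-! ### Closed covers of the simplex -/

/-- Scarf's lemma on the grid of points with coordinates in `N⁻¹ ℕ`, ranked by their coordinates.
The points of a dominant set are close to each other, since its coordinatewise minima over the labels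
that occur sum to almost `1`; the coordinates of the remaining labels are almost `0`. -/
lemma exists_approx_of_cover {I : Type*} [Fintype I] (B : I → Set (I → ℝ))
    (hB : ∀ x ∈ stdSimplex ℝ I, ∃ i, x ∈ B i) [Nonempty I] (N : ℕ) (hN : 0 < N) :
    ∃ x ∈ stdSimplex ℝ I, ∀ i, x i ≤ (Fintype.card I : ℝ) / N ∨
      ∃ z ∈ B i, z ∈ stdSimplex ℝ I ∧ dist x z ≤ (Fintype.card I : ℝ) / N := by
  classical
  let T := {k : I → ℕ // k ∈ Finset.piAntidiag Finset.univ N}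
  have hsum : ∀ t : T, ∑ i, t.1 i = N := fun t => (Finset.mem_piAntidiag.1 t.2).1
  have hmk : ∀ k : I → ℕ, ∑ i, k i = N → k ∈ Finset.piAntidiag Finset.univ N := fun k hk =>
    Finset.mem_piAntidiag.2 ⟨hk, fun _ _ => Finset.mem_univ _⟩
  have hN' : (0 : ℝ) < N := by exact_mod_cast hN
  let P : T → I → ℝ := fun t i => (t.1 i : ℝ) / N
  have hP : ∀ t, P t ∈ stdSimplex ℝ I := by
    intro t
    refine ⟨fun i => by positivity, ?_⟩
    simp only [P]
    rw [← Finset.sum_div, ← Nat.cast_sum, hsum, div_self hN'.ne']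
  choose c hc using fun t : T => hB (P t) (hP t)
  obtain ⟨j₀⟩ := ‹Nonempty I›
  have : Fintype T := inferInstanceAs (Fintype (Finset.piAntidiag Finset.univ N))
  have : Nonempty T := ⟨⟨Pi.single j₀ N, hmk _ (by simp)⟩⟩
  obtain ⟨σ, ⟨x, hx⟩, hσ⟩ := exists_dominant_labels (N := N) (fun i (t : T) => t.1 i)
    (fun i t => (Finset.single_le_sum (f := t.1) (fun _ _ => Nat.zero_le _)
      (Finset.mem_univ i)).trans_eq (hsum t)) c
  let C : Finset I := σ.image c
  choose m hmσ hm using fun i => Finset.exists_min_image σ (fun t : T => t.1 i) ⟨x, hx⟩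
  -- otherwise some grid point would exceed all the minima over the labels in `C`
  have hbig : N < ∑ i ∈ C, ((m i).1 i + 1) := by
    by_contra! hle
    have hxC : c x ∈ C := Finset.mem_image_of_mem c hx
    let k : I → ℕ := fun i => (if i ∈ C then (m i).1 i + 1 else 0) +
      if i = c x then N - ∑ i ∈ C, ((m i).1 i + 1) else 0
    have hk : ∑ i, k i = N := by
      simp only [k, Finset.sum_add_distrib, Finset.sum_ite_mem, Finset.univ_inter,
        Finset.sum_ite_eq', Finset.mem_univ, if_true]
      simp only [Finset.sum_add_distrib] at hle ⊢
      omega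
    obtain ⟨i, ⟨z, hz, hzi⟩, hi⟩ := hσ ⟨k, hmk k hk⟩
    have hiC : i ∈ C := hzi ▸ Finset.mem_image_of_mem c hz
    have := hi _ (hmσ i)
    simp only [k, if_pos hiC] at this
    omega
  have hbig' : N ≤ ∑ i ∈ C, (m i).1 i + Fintype.card I := by
    rw [Finset.sum_add_distrib] at hbig
    have : ∑ i ∈ C, 1 ≤ Fintype.card I := by simpa using Finset.card_le_univ C
    omega
  have hle : ∀ z ∈ σ, ∑ i ∈ C, z.1 i + ∑ i ∈ Cᶜ, z.1 i = N := by
    intro z _; rw [Finset.sum_add_sum_compl, hsum]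
  have hin : ∀ z ∈ σ, ∀ i ∈ C, z.1 i ≤ (m i).1 i + Fintype.card I := by
    intro z hz i hi
    have h1 := hle z hz
    have h2 := Finset.add_sum_erase C (fun i => z.1 i) hi
    have h3 := Finset.add_sum_erase C (fun i => (m i).1 i) hi
    have h4 : ∑ i ∈ C.erase i, (m i).1 i ≤ ∑ i ∈ C.erase i, z.1 i :=
      Finset.sum_le_sum fun i _ => hm i z hz
    omega
  have hout : ∀ z ∈ σ, ∀ i ∉ C, z.1 i ≤ Fintype.card I := by
    intro z hz i hi
    have h1 := hle z hz
    have h2 : z.1 i ≤ ∑ i ∈ Cᶜ, z.1 i :=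
      Finset.single_le_sum (f := fun i => z.1 i) (fun _ _ => Nat.zero_le _) (by simpa using hi)
    have h4 : ∑ i ∈ C, (m i).1 i ≤ ∑ i ∈ C, z.1 i :=
      Finset.sum_le_sum fun i _ => hm i z hz
    omega
  have hclose : ∀ z ∈ σ, ∀ w ∈ σ, ∀ i, z.1 i ≤ w.1 i + Fintype.card I := by
    intro z hz w hw i
    by_cases hi : i ∈ C
    · have := hin z hz i hi
      have := hm i w hw
      omega
    · have := hout z hz i hi
      omega
  refine ⟨P x, hP x, fun i => ?_⟩
  by_cases hi : i ∈ C
  · obtain ⟨z, hz, rfl⟩ := Finset.mem_image.1 hi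
    refine Or.inr ⟨P z, hc z, hP z, (dist_pi_le_iff (by positivity)).2 fun j => ?_⟩
    simp only [P]
    rw [Real.dist_eq, ← sub_div, abs_div, abs_of_pos hN']
    refine div_le_div_of_nonneg_right ?_ hN'.le
    have h1 : (x.1 j : ℝ) ≤ z.1 j + Fintype.card I := by exact_mod_cast hclose x hx z hz j
    have h2 : (z.1 j : ℝ) ≤ x.1 j + Fintype.card I := by exact_mod_cast hclose z hz x hx j
    rw [abs_le]; constructor <;> linarith
  · left
    exact div_le_div_of_nonneg_right (by exact_mod_cast hout x hx i hi) hN'.le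

/-- If closed sets `B i` cover the simplex, some point lies in `B i` for every `i` in its support.
Applied to `B i = {x | x i ≤ φ x i}` this is Brouwer's fixed point theorem for `φ`. -/
lemma exists_mem_of_closed_cover {I : Type*} [Fintype I] [Nonempty I] (B : I → Set (I → ℝ))
    (hBc : ∀ i, IsClosed (B i)) (hB : ∀ x ∈ stdSimplex ℝ I, ∃ i, x ∈ B i) :
    ∃ x ∈ stdSimplex ℝ I, ∀ i, x i = 0 ∨ x ∈ B i := by
  choose x hx hxi using fun n : ℕ => exists_approx_of_cover B hB (n + 1) n.succ_pos
  obtain ⟨a, ha, φ, hφ, hlim⟩ := (isCompact_stdSimplex ℝ I).tendsto_subseq hx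
  have hε : Filter.Tendsto (fun n : ℕ => (Fintype.card I : ℝ) / ((φ n + 1 : ℕ) : ℝ))
      Filter.atTop (nhds 0) :=
    ((tendsto_const_div_atTop_nhds_zero_nat (Fintype.card I : ℝ)).comp
      (Filter.tendsto_add_atTop_nat 1)).comp hφ.tendsto_atTop
  refine ⟨a, ha, fun i => ?_⟩
  by_contra! hcon
  obtain ⟨h0, hBi⟩ := hcon
  have hpos : 0 < a i := lt_of_le_of_ne (ha.1 i) (Ne.symm h0)
  obtain ⟨δ, hδ, hball⟩ := Metric.isOpen_iff.1 (hBc i).isOpen_compl a hBi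
  have h1 : ∀ᶠ n in Filter.atTop, dist (x (φ n)) a < min (δ / 2) (a i / 2) :=
    hlim.eventually (Metric.ball_mem_nhds a (by positivity))
  have h2 : ∀ᶠ n in Filter.atTop,
      (Fintype.card I : ℝ) / ((φ n + 1 : ℕ) : ℝ) < min (δ / 2) (a i / 2) :=
    hε.eventually (gt_mem_nhds (by positivity))
  obtain ⟨n, hn1, hn2⟩ := (h1.and h2).exists
  rw [lt_min_iff] at hn1 hn2
  rcases hxi (φ n) i with h | ⟨z, hzB, -, hz⟩
  · have h3 := dist_le_pi_dist (x (φ n)) a i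
    rw [Real.dist_eq] at h3
    have h4 := neg_abs_le (x (φ n) i - a i)
    linarith [hn1.2, hn2.2]
  · refine hball ?_ hzB
    rw [Metric.mem_ball]
    have := dist_triangle_left z a (x (φ n))
    linarith [hn1.1, hn2.1]

/-- The **Knaster–Kuratowski–Mazurkiewicz** lemma for the zero sets of continuous nonnegative
functions `g i`. -/
lemma exists_forall_eq_zero_of_kkm {I : Type*} [Fintype I] [Nonempty I] (g : I → (I → ℝ) → ℝ)
    (hg : ∀ i, Continuous (g i)) (hg0 : ∀ i x, 0 ≤ g i x)
    (hkkm : ∀ x ∈ stdSimplex ℝ I, ∃ i, 0 < x i ∧ g i x = 0) :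
    ∃ x ∈ stdSimplex ℝ I, ∀ i, g i x = 0 := by
  -- at a point with `x i * ∑ j, g j x ≤ g i x` for all `i`, the choice of `i` in `hkkm`
  -- makes the sum vanish
  obtain ⟨x, hx, h⟩ := exists_mem_of_closed_cover (fun i => {x | x i * ∑ j, g j x ≤ g i x})
    (fun i => isClosed_le (by fun_prop) (hg i)) (by
      intro x hx
      by_contra! hcon
      have hlt : ∑ i, g i x < ∑ i, x i * ∑ j, g j x :=
        Finset.sum_lt_sum_of_nonempty Finset.univ_nonempty fun i _ => not_le.1 (hcon i)
      rw [← Finset.sum_mul, hx.2, one_mul] at hlt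
      exact lt_irrefl _ hlt)
  obtain ⟨j, hj, hgj⟩ := hkkm x hx
  have hS : ∑ i, g i x = 0 := by
    have h0 : 0 ≤ ∑ i, g i x := Finset.sum_nonneg fun i _ => hg0 i x
    rcases h j with h1 | h1
    · exact absurd h1 hj.ne'
    · rw [Set.mem_ofPred_eq, hgj] at h1
      exact le_antisymm (nonpos_of_mul_nonpos_right h1 hj) h0
  exact ⟨x, hx, fun i => (Finset.sum_eq_zero_iff_of_nonneg fun i _ => hg0 i x).1 hS i
    (Finset.mem_univ i)⟩

/-! ### The fixed point -/

theorem theorem3 {X : Type*} [MetricSpace X] [AddCommGroup X] [Module ℝ X]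
    [IsTopologicalAddGroup X] [ContinuousSMul ℝ X]
    (C : Set X) (hCne : C.Nonempty) (hCclosed : IsClosed C) (hCconv : Convex ℝ C)
    (f : C → C) (ha : Function.Surjective f)
    (hb : ∀ (s : Finset C) (α : C → ℝ), (∀ x ∈ s, 0 < α x) → ∑ x ∈ s, α x = 1 →
      ∃ x ∈ s, 0 ≤ dist (f x : X) (∑ y ∈ s, α y • (y : X)) - dist (f x : X) (x : X))
    (hc : ∃ x : C, IsCompact {y : X | y ∈ C ∧ dist (f x : X) (x : X) ≤ dist (f x : X) y}) :
    ∃ x : C, f x = x := by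
  classical
  obtain ⟨p, hp⟩ := hc
  let G : C → Set X := fun x => {y : X | y ∈ C ∧ dist (f x : X) (x : X) ≤ dist (f x : X) y}
  have hGc : ∀ x, IsClosed (G x) := fun x =>
    hCclosed.inter (isClosed_le continuous_const (continuous_const.dist continuous_id))
  have hfin : ∀ s : Finset C, s.Nonempty → ∃ y, ∀ x ∈ s, y ∈ G x := by
    intro s hs
    have : Nonempty s := hs.to_subtype
    let u : (s → ℝ) → X := fun t => ∑ i, t i • ((i : C) : X)
    have hu : Continuous u := by fun_prop
    obtain ⟨t, ht, hzero⟩ := exists_forall_eq_zero_of_kkm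
      (fun (i : s) t => max 0 (dist (f i : X) ((i : C) : X) - dist (f i : X) (u t)))
      (fun i => by fun_prop) (fun i t => le_max_left _ _) (by
        intro t ht
        let β : C → ℝ := fun x => if h : x ∈ s then t ⟨x, h⟩ else 0
        have hβ : ∀ i : s, β i = t i := fun i => by simp [β]
        -- the condition on `f` concerns positive weights only, so restrict to the support of `t`
        have hβ0 : ∀ x ∈ s, x ∉ s.filter (fun x => 0 < β x) → β x = 0 := fun x hx hx' =>
          le_antisymm (not_lt.1 fun h => hx' (Finset.mem_filter.2 ⟨hx, h⟩))
            (by rw [hβ ⟨x, hx⟩]; exact ht.1 _)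
        -- the condition on `f` concerns positive weights only, so restrict to the support of `t`
        obtain ⟨x, hx, hxd⟩ := hb (s.filter fun x => 0 < β x) β
          (fun x hx => (Finset.mem_filter.1 hx).2) (by
            rw [Finset.sum_subset (Finset.filter_subset _ s) hβ0, ← Finset.sum_coe_sort s β]
            simp only [hβ]; exact ht.2)
        rw [Finset.sum_subset (Finset.filter_subset _ s)
          (fun x hx hx' => by rw [hβ0 x hx hx', zero_smul]),
          ← Finset.sum_coe_sort s (fun y => β y • (y : X))] at hxd
        simp only [hβ] at hxd
        obtain ⟨hxs, hxpos⟩ := Finset.mem_filter.1 hx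
        refine ⟨⟨x, hxs⟩, by rw [← hβ]; exact hxpos, max_eq_left ?_⟩
        simp only [u]
        linarith)
    refine ⟨u t, fun x hx => ⟨?_, ?_⟩⟩
    · exact hCconv.sum_mem (fun i _ => ht.1 i) ht.2 fun i _ => (i : C).2
    · have h := le_of_le_of_eq (le_max_right _ _) (hzero ⟨x, hx⟩)
      simp only at h
      linarith
  obtain ⟨y, -, hy⟩ := IsCompact.inter_iInter_nonempty hp G hGc (by
    intro s
    obtain ⟨y, hy⟩ := hfin (insert p s) (Finset.insert_nonempty _ _)
    exact ⟨y, hy p (Finset.mem_insert_self _ _),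
      Set.mem_iInter₂.2 fun x hx => hy x (Finset.mem_insert_of_mem hx)⟩)
  rw [Set.mem_iInter] at hy
  obtain ⟨x, hx⟩ := ha ⟨y, (hy p).1⟩
  have h := (hy x).2
  rw [hx, dist_self] at h
  exact ⟨x, hx.trans (Subtype.ext (dist_le_zero.1 h))⟩
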